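/- Let $\mathbf{R}_*$ be the poset category of the positive real numbers, let $\mathbb{F}$ be a field, let $n\ge 0$ be an integer, and let $\mathcal{X},\mathcal{Y}:\mathbf{R}_*\to\mathbf{Top}$ be functors, written $r\mapsto X_r$ and $r\mapsto Y_r$. **Products.** The categorical product $\mathcal{X}\times\mathcal{Y}:\mathbf{R}_*\to\mathbf{Top}$ sends $r$ to $X_r\times Y_r$ (product topology) and $r\le s$ to $\mathcal{X}(r\le s)\times\mathcal{Y}(r\le s)$. Let $\mathcal{X}\boxtimes\mathcal{Y}$ be the functor on $\mathbf{R}_*^2$ that sends $(i,j)$ to $X_i\times Y_j$, with the product maps, and for $r>0$ let $\triangle_r=\{(i,j)\in\mathbf{R}_*^2 : i+j\le r\}$ with the product order. The generalized tensor product $\mathcal{X}\otimes_{\mathbf{g}}\mathcal{Y}:\mathbf{R}_*\to\mathbf{Top}$ sends $r$ to $\mathsf{hocolim}\big((\mathcal{X}\boxtimes\mathcal{Y})|_{\triangle_r}\big)$ and $r\le s$ to the map induced by the change of indexing category $\triangle_r\subset\triangle_s$. Here, for a small category $\mathbf{I}$ and $D:\mathbf{I}\to\mathbf{Top}$, $$\mathsf{hocolim}(D)=\mathsf{coeq}\Big[\coprod_{i\to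 j}D(i)\times\mathcal{B}(j\downarrow\mathbf{I})^{op}\rightrightarrows\coprod_{i}D(i)\times\mathcal{B}(i\downarrow\mathbf{I})^{op}\Big],$$ where $\mathcal{B}$ is the classifying space (geometric realization of the nerve), $(i\downarrow\mathbf{I})$ is the undercategory, and on the summand of $f:i\to j$ one map is $D(f)\times\mathrm{id}$ (landing in the summand of $j$) and the other is $\mathrm{id}\times f^*$ (landing in the summand of $i$), with $f^*$ induced by precomposition with $f$. **Reparametrization and homology.** For $\mathcal{Z}:\mathbf{R}_*\to\mathbf{Top}$ let $\mathbf{ln}(\mathcal{Z}):\mathbf{R}\to\mathbf{Top}$ be $r\mapsto\mathcal{Z}(e^r)$, with the maps $\mathcal{Z}(e^r\le e^{s})$ for $r\le s$. Let $H_n(\mathbf{ln}(\mathcal{Z});\mathbb{F}):\mathbf{R}\to\mathbf{Mod}_{\mathbb{F}}$ be the functor obtained by applying degree-$n$ singular homology with coefficients in $\mathbb{F}$. **Interleavings.** For $\mathcal{M}:\mathbf{R}\to\mathbf{Mod}_{\mathbb{F}}$ and $\delta\ge0$ let $T_\delta\mathcal{M}(r)=\mathcal{M}(r+\delta)$. Two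 such functors $\mathcal{M},\mathcal{N}$ are $\delta$-interleaved if there are natural transformations $\varphi:\mathcal{M}\to T_\delta\mathcal{N}$ and $\psi:\mathcal{N}\to T_\delta\mathcal{M}$ such that, for all $r$, $\psi_{r+\delta}\circ\varphi_r=\mathcal{M}(r\le r+2\delta)$ and $\varphi_{r+\delta}\circ\psi_r=\mathcal{N}(r\le r+2\delta)$. The interleaving distance $d_I(\mathcal{M},\mathcal{N})\in[0,\infty]$ is the infimum of all $\delta\ge0$ for which $\mathcal{M}$ and $\mathcal{N}$ are $\delta$-interleaved ($\infty$ if there are none). **Theorem.** The functors $H_n\big(\mathbf{ln}(\mathcal{X}\times\mathcal{Y});\mathbb{F}\big)$ and $H_n\big(\mathbf{ln}(\mathcal{X}\otimes_{\mathbf{g}}\mathcal{Y});\mathbb{F}\big)$ are $\ln(2)$-interleaved, and consequently $$d_I\Big(H_n\big(\mathbf{ln}(\mathcal{X}\times\mathcal{Y});\mathbb{F}\big),\,H_n\big(\mathbf{ln}(\mathcal{X}\otimes_{\mathbf{g}}\mathcal{Y});\mathbb{F}\big)\Big)\le\ln(2).$$ -/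

import Mathlib

open CategoryTheory

universe w u v u₁ v₁

/-! ### Classifying spaces and homotopy colimits -/

section HomotopyColimit

/-- The classifying space `ℬ C` of a category: the geometric realization of its nerve. -/
noncomputable def classifyingSpace (C : Type u) [Category.{v} C] : TopCat.{max u v} :=
  SSet.toTop.obj (nerve C)

/-- The continuous map of classifying spaces induced by a functor. -/
noncomputable def classifyingSpaceMap {C D : Type u₁} [Category.{v₁} C] [Category.{v₁} D]
    (F : C ⥤ D) : classifyingSpace C ⟶ classifyingSpace D :=
  SSet.toTop.map (nerveMap F)

theorem classifyingSpaceMap_id (C : Type u₁) [Category.{v₁} C] :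
    classifyingSpaceMap (𝟭 C) = 𝟙 (classifyingSpace C) :=
  SSet.toTop.map_id _

theorem classifyingSpaceMap_comp {C D E : Type u₁} [Category.{v₁} C] [Category.{v₁} D]
    [Category.{v₁} E] (F : C ⥤ D) (G : D ⥤ E) :
    classifyingSpaceMap (F ⋙ G) = classifyingSpaceMap F ≫ classifyingSpaceMap G :=
  SSet.toTop.map_comp (nerveMap F) (nerveMap G)

/-- The space `ℬ (i ↓ I)ᵒᵖ`, where `(i ↓ I)` is the undercategory of `i`. -/
noncomputable abbrev underSpace {I : Type u₁} [Category.{v₁} I] (i : I) : TopCat.{max u₁ v₁} :=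
  classifyingSpace (Under i)ᵒᵖ

/-- A morphism `i ⟶ j` induces, by precomposition, `ℬ (j ↓ I)ᵒᵖ ⟶ ℬ (i ↓ I)ᵒᵖ`. -/
noncomputable def underSpaceMap {I : Type u₁} [Category.{v₁} I] {i j : I} (f : i ⟶ j) :
    underSpace j ⟶ underSpace i :=
  classifyingSpaceMap (Under.map f).op

/-- The disjoint union `∐ i, D(i) × ℬ (i ↓ I)ᵒᵖ`. -/
abbrev HocolimTotal {I : Type u₁} [Category.{v₁} I] (D : I ⥤ TopCat.{w}) : Type max u₁ v₁ w :=
  Σ i : I, D.obj i × underSpace i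

/-- The gluing relation defining the coequalizer: for `f : i ⟶ j`, `x ∈ D(i)` and
`b ∈ ℬ (j ↓ I)ᵒᵖ`, the point `(D(f) x, b)` over `j` is identified with `(x, f^* b)` over `i`. -/
inductive HocolimRel {I : Type u₁} [Category.{v₁} I] (D : I ⥤ TopCat.{w}) :
    HocolimTotal D → HocolimTotal D → Prop
  | glue {i j : I} (f : i ⟶ j) (x : D.obj i) (b : underSpace j) :
      HocolimRel D ⟨j, (D.map f x, b)⟩ ⟨i, (x, underSpaceMap f b)⟩

/-- The homotopy colimit of `D`: the coequalizer in topological spaces of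
`∐_{i → j} D(i) × ℬ (j ↓ I)ᵒᵖ ⇉ ∐_i D(i) × ℬ (i ↓ I)ᵒᵖ`, that is, the quotient of the disjoint
union by the equivalence relation generated by `HocolimRel`, with the quotient topology. -/
noncomputable def hocolim {I : Type u₁} [Category.{v₁} I] (D : I ⥤ TopCat.{w}) :
    TopCat.{max u₁ v₁ w} :=
  TopCat.of (Quot (HocolimRel D))

/-- The map `ℬ (i ↓ I)ᵒᵖ ⟶ ℬ (F i ↓ J)ᵒᵖ` induced by a functor `F : I ⥤ J`. -/
noncomputable def underSpacePost {I J : Type u₁} [Category.{v₁} I] [Category.{v₁} J]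
    (F : I ⥤ J) (i : I) : underSpace i ⟶ underSpace (F.obj i) :=
  classifyingSpaceMap (Under.post F).op

theorem underSpacePost_naturality {I J : Type u₁} [Category.{v₁} I] [Category.{v₁} J]
    (F : I ⥤ J) {i j : I} (f : i ⟶ j) :
    underSpaceMap f ≫ underSpacePost F i = underSpacePost F j ≫ underSpaceMap (F.map f) := by
  have h : Under.map f ⋙ Under.post F = Under.post F ⋙ Under.map (F.map f) := by
    have hobj : ∀ X, (Under.map f ⋙ Under.post F).obj X =
        (Under.post F ⋙ Under.map (F.map f)).obj X :=
      fun X => congrArg Under.mk (F.map_comp f X.hom)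
    refine CategoryTheory.Functor.ext hobj (fun X Y g => ?_)
    apply Under.UnderMorphism.ext
    rw [Under.comp_right, Under.comp_right, Under.eqToHom_right, Under.eqToHom_right]
    exact ((Category.id_comp _).trans (Category.comp_id _)).symm
  have h' : (Under.map f).op ⋙ (Under.post F).op =
      (Under.post F).op ⋙ (Under.map (F.map f)).op := congrArg Functor.op h
  rw [underSpaceMap, underSpacePost, underSpaceMap, underSpacePost,
    ← classifyingSpaceMap_comp, ← classifyingSpaceMap_comp]
  exact congrArg classifyingSpaceMap h'

/-- The change of indexing category `φ_F : hocolim (D ∘ F) ⟶ hocolim D`,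
`[i, x, b] ↦ [F i, x, F_* b]`. -/
noncomputable def hocolimReindex {I J : Type u₁} [Category.{v₁} I] [Category.{v₁} J]
    (F : I ⥤ J) (D : J ⥤ TopCat.{w}) : hocolim (F ⋙ D) ⟶ hocolim D :=
  TopCat.ofHom
    { toFun := Quot.map (ra := HocolimRel (F ⋙ D)) (rb := HocolimRel D)
        (fun p => ⟨F.obj p.1, (p.2.1, underSpacePost F p.1 p.2.2)⟩) (by
          rintro _ _ ⟨f, x, b⟩
          have h := ConcreteCategory.congr_hom (underSpacePost_naturality F f) b
          simp only [ConcreteCategory.comp_apply] at h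
          dsimp only
          rw [h]
          exact HocolimRel.glue (F.map f) x _)
      continuous_toFun := continuous_quot_map _ (continuous_sigma fun i =>
        (continuous_sigmaMk (σ := fun j : J => D.obj j × underSpace j) (i := F.obj i)).comp
          (continuous_fst.prodMk ((underSpacePost F i).hom.continuous.comp continuous_snd))) }

theorem hocolimReindex_id {I : Type u₁} [Category.{v₁} I] (D : I ⥤ TopCat.{w}) :
    hocolimReindex (𝟭 I) D = 𝟙 (hocolim D) := by
  ext p
  obtain ⟨i, x, b⟩ := p
  have h : underSpacePost (𝟭 I) i = 𝟙 (underSpace i) := classifyingSpaceMap_id _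
  exact congrArg (fun g : underSpace i ⟶ underSpace i =>
    Quot.mk (HocolimRel D) ⟨i, (x, g b)⟩) h

theorem hocolimReindex_comp {I J K : Type u₁} [Category.{v₁} I] [Category.{v₁} J]
    [Category.{v₁} K] (F : I ⥤ J) (G : J ⥤ K) (D : K ⥤ TopCat.{w}) :
    hocolimReindex (F ⋙ G) D = hocolimReindex F (G ⋙ D) ≫ hocolimReindex G D := by
  ext p
  obtain ⟨i, x, b⟩ := p
  have h : underSpacePost (F ⋙ G) i = underSpacePost F i ≫ underSpacePost G (F.obj i) :=
    classifyingSpaceMap_comp (Under.post F).op (Under.post (X := F.obj i) G).op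
  exact congrArg (fun g : underSpace i ⟶ underSpace (G.obj (F.obj i)) =>
    Quot.mk (HocolimRel D) ⟨G.obj (F.obj i), (x, g b)⟩) h

end HomotopyColimit

/-! ### Products of diagrams of spaces indexed by the positive reals -/

section Products

/-- The poset of positive real numbers. -/
abbrev PosReal : Type := {r : ℝ // 0 < r}

/-- The external product `𝒳 ⊠ 𝒴`, sending `(i, j)` to `X_i × Y_j` with the product topology. -/
def boxProduct (X Y : PosReal ⥤ TopCat.{w}) : PosReal × PosReal ⥤ TopCat.{w} where
  obj p := TopCat.of (X.obj p.1 × Y.obj p.2)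
  map f := TopCat.ofHom ((X.map f.1).hom.prodMap (Y.map f.2).hom)
  map_id p := by
    ext q
    · exact ConcreteCategory.congr_hom (X.map_id p.1) q.1
    · exact ConcreteCategory.congr_hom (Y.map_id p.2) q.2
  map_comp f g := by
    ext q
    · exact ConcreteCategory.congr_hom (X.map_comp f.1 g.1) q.1
    · exact ConcreteCategory.congr_hom (Y.map_comp f.2 g.2) q.2

/-- The categorical product `𝒳 × 𝒴`, sending `r` to `X_r × Y_r` with the product topology. -/
def catProduct (X Y : PosReal ⥤ TopCat.{w}) : PosReal ⥤ TopCat.{w} :=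
  Functor.diag PosReal ⋙ boxProduct X Y

/-- The poset `△_r = {(i, j) : i + j ≤ r}` of pairs of positive reals, with the product order. -/
abbrev Triangle (r : PosReal) : Type :=
  {p : PosReal × PosReal // (p.1 : ℝ) + (p.2 : ℝ) ≤ (r : ℝ)}

/-- The inclusion of `△_r` into the product category. -/
def triangleIncl (r : PosReal) : Triangle r ⥤ PosReal × PosReal where
  obj p := p.1
  map f := (homOfLE (leOfHom f).1, homOfLE (leOfHom f).2)

/-- The inclusion `△_r ⊆ △_s` for `r ≤ s`. -/
def triangleMap {r s : PosReal} (h : r ≤ s) : Triangle r ⥤ Triangle s where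
  obj p := ⟨p.1, p.2.trans h⟩
  map f := homOfLE (leOfHom f)

/-- The generalized tensor product `𝒳 ⊗_g 𝒴`, sending `r` to the homotopy colimit of the
restriction of `𝒳 ⊠ 𝒴` to `△_r`, and `r ≤ s` to the change of indexing category along
`△_r ⊆ △_s`. -/
noncomputable def genTensor (X Y : PosReal ⥤ TopCat.{w}) : PosReal ⥤ TopCat.{w} where
  obj r := hocolim (triangleIncl r ⋙ boxProduct X Y)
  map {_ s} f := hocolimReindex (triangleMap (leOfHom f)) (triangleIncl s ⋙ boxProduct X Y)
  map_id r := hocolimReindex_id (triangleIncl r ⋙ boxProduct X Y)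
  map_comp {_ _ t} f g := hocolimReindex_comp (triangleMap (leOfHom f)) (triangleMap (leOfHom g))
    (triangleIncl t ⋙ boxProduct X Y)

/-- The exponential `ℝ → ℝ_{>0}` as a functor between poset categories. -/
noncomputable def expFunctor : ℝ ⥤ PosReal where
  obj r := ⟨Real.exp r, Real.exp_pos r⟩
  map f := homOfLE (Subtype.mk_le_mk.mpr (Real.exp_le_exp.mpr (leOfHom f)))

/-- The logarithmic reparametrization `ln(𝒳)(r) = 𝒳(e^r)`. -/
noncomputable def lnDiagram (X : PosReal ⥤ TopCat.{w}) : ℝ ⥤ TopCat.{w} :=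
  expFunctor ⋙ X

end Products

/-! ### Persistent homology and interleavings -/

section Interleavings

/-- `H_n(𝒳; 𝔽)`, obtained by applying singular homology in degree `n` with coefficients in `𝔽` to
every space and map of the diagram. -/
noncomputable def diagramHomology (F : Type u) [Field F] (n : ℕ) {I : Type u₁} [Category.{v₁} I]
    (X : I ⥤ TopCat.{w}) : I ⥤ ModuleCat.{max u w} F :=
  X ⋙ (AlgebraicTopology.singularHomologyFunctor (ModuleCat.{max u w} F) n).obj
    (ModuleCat.of F (ULift.{w} F))

variable {C : Type u₁} [Category.{v₁} C]

/-- Translation by `δ` on the poset of real numbers. -/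
def translation (δ : ℝ) : ℝ ⥤ ℝ where
  obj r := r + δ
  map f := homOfLE (add_le_add_left (leOfHom f) δ)

/-- The `δ`-shift `T_δ(M)(r) = M(r + δ)`. -/
def shiftDiagram (δ : ℝ) (M : ℝ ⥤ C) : ℝ ⥤ C :=
  translation δ ⋙ M

/-- `M` and `N` are `δ`-interleaved: there are `φ : M ⟶ T_δ N` and `ψ : N ⟶ T_δ M` with
`T_δ(ψ) ∘ φ = T_{2δ}^M` and `T_δ(φ) ∘ ψ = T_{2δ}^N`, the transition morphisms. -/
def AreInterleaved (δ : ℝ) (M N : ℝ ⥤ C) : Prop :=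
  ∃ (hδ : 0 ≤ δ) (φ : M ⟶ shiftDiagram δ N) (ψ : N ⟶ shiftDiagram δ M),
    (∀ r : ℝ, φ.app r ≫ ψ.app (r + δ) = M.map (homOfLE (by linarith : r ≤ r + δ + δ))) ∧
    (∀ r : ℝ, ψ.app r ≫ φ.app (r + δ) = N.map (homOfLE (by linarith : r ≤ r + δ + δ)))

/-- The interleaving distance: the infimum of all `δ ≥ 0` such that `M` and `N` are
`δ`-interleaved, and `∞` if there are none. -/
noncomputable def interleavingDistance (M N : ℝ ⥤ C) : ENNReal :=
  ⨅ (δ : ℝ) (_ : AreInterleaved δ M N), ENNReal.ofReal δ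

end Interleavings

/-! ### Maps out of a geometric realization -/

section Realization

open Opposite

/-! After the logarithmic change of variable, doubling the scale becomes a shift by `Real.log 2`, so
it suffices to compare the two products up to a factor 2. Since (r, r) lies in △_{2r}, the space X_r
× Y_r includes into the homotopy colimit at 2r. Conversely, i + j ≤ r with i, j > 0 forces i, j ≤ r,
so the homotopy colimit at r collapses onto X_r × Y_r.

Going from the product to the tensor and back is strictly the transition map. For the other
composite, (r, r) is an upper bound in △_{2r} of all of △_r. Hence in each undercategory of △_{2r},
the part coming from △_r can be coned off to the vertex (r, r), compatibly with the gluing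
(`hocolimReindexHomotopy`). The inclusions are natural in r only up to homotopy
(`hocolimInclusionHomotopy`), which is why the interleaving is obtained after applying homology.

The cones are built simplex by simplex. Homotopies are encoded as maps into a path space, so that
the universal properties of realizations and quotients apply directly and no product with the
interval has to be commuted past a colimit. -/

/-- The characteristic map of a simplex in the geometric realization. -/
noncomputable def realizationSimplex {S : SSet.{u}} {n : SimplexCategory} (x : S.obj (op n)) :
    C(stdSimplex ℝ (Fin (n.len + 1)), SSet.toTop.obj S) :=
  TopCat.toSSetObjEquiv _ _ ((sSetTopAdj.unit.app S).app _ x)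

theorem realizationSimplex_map {S : SSet.{u}} {m n : SimplexCategory} (f : m ⟶ n)
    (x : S.obj (op n)) (t : stdSimplex ℝ (Fin (m.len + 1))) :
    realizationSimplex (S.map f.op x) t = realizationSimplex x (stdSimplex.map f t) := by
  have h := ConcreteCategory.congr_hom ((sSetTopAdj.unit.app S).naturality f.op) x
  exact DFunLike.congr_fun (congrArg (TopCat.toSSetObjEquiv _ _) h) t

theorem toTop_map_realizationSimplex {S T : SSet.{u}} (g : S ⟶ T) {n : SimplexCategory}
    (x : S.obj (op n)) (t : stdSimplex ℝ (Fin (n.len + 1))) :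
    SSet.toTop.map g (realizationSimplex x t) = realizationSimplex (g.app _ x) t := by
  have h := ConcreteCategory.congr_hom
    (NatTrans.congr_app (sSetTopAdj.unit.naturality g) (op n)) x
  exact (DFunLike.congr_fun (congrArg (TopCat.toSSetObjEquiv _ _) h) t).symm

/-- Transposing along the adjunction with the singular set functor turns this into equality of two
simplicial maps. -/
theorem realization_hom_ext {S : SSet.{u}} {X : TopCat.{u}} {f g : SSet.toTop.obj S ⟶ X}
    (h : ∀ (n : SimplexCategory) (x : S.obj (op n)) (t : stdSimplex ℝ (Fin (n.len + 1))),
      f (realizationSimplex x t) = g (realizationSimplex x t)) : f = g := by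
  apply (sSetTopAdj.homEquiv _ _).injective
  rw [Adjunction.homEquiv_unit, Adjunction.homEquiv_unit]
  ext ⟨n⟩ x
  exact (TopCat.toSSetObjEquiv X (op n)).injective (ContinuousMap.ext (h n x))

/-- The map out of a geometric realization given by a compatible family of maps out of the
simplices. -/
noncomputable def realizationDesc {S : SSet.{u}} {X : TopCat.{u}}
    (φ : ∀ {n : SimplexCategory}, S.obj (op n) → C(stdSimplex ℝ (Fin (n.len + 1)), X))
    (hφ : ∀ {m n : SimplexCategory} (f : m ⟶ n) (x : S.obj (op n))
      (t : stdSimplex ℝ (Fin (m.len + 1))), φ (S.map f.op x) t = φ x (stdSimplex.map f t)) :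
    SSet.toTop.obj S ⟶ X :=
  (sSetTopAdj.homEquiv S X).symm
    { app n := ↾fun x => (TopCat.toSSetObjEquiv X n).symm (φ (n := n.unop) x)
      naturality := by
        rintro ⟨n⟩ ⟨m⟩ ⟨f⟩
        ext x
        exact (TopCat.toSSetObjEquiv X (op m)).injective (ContinuousMap.ext (hφ f x)) }

theorem realizationDesc_simplex {S : SSet.{u}} {X : TopCat.{u}}
    (φ : ∀ {n : SimplexCategory}, S.obj (op n) → C(stdSimplex ℝ (Fin (n.len + 1)), X))
    (hφ : ∀ {m n : SimplexCategory} (f : m ⟶ n) (x : S.obj (op n))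
      (t : stdSimplex ℝ (Fin (m.len + 1))), φ (S.map f.op x) t = φ x (stdSimplex.map f t))
    {n : SimplexCategory} (x : S.obj (op n)) (t : stdSimplex ℝ (Fin (n.len + 1))) :
    realizationDesc φ hφ (realizationSimplex x t) = φ x t := by
  have h : (sSetTopAdj.homEquiv S X) (realizationDesc φ hφ) = _ := Equiv.apply_symm_apply _ _
  rw [Adjunction.homEquiv_unit] at h
  have h' := ConcreteCategory.congr_hom (NatTrans.congr_app h (op n)) x
  exact DFunLike.congr_fun (congrArg (TopCat.toSSetObjEquiv _ _) h') t

end Realization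

/-! ### Cones on simplices -/

section Cone

open unitInterval Opposite

/-- The point of the cone on a simplex at parameter `s` above `t`; the apex, at `s = 1`, is the
vertex `0`. -/
noncomputable def simplexCone {n : ℕ} (s : I) (t : stdSimplex ℝ (Fin n)) :
    stdSimplex ℝ (Fin (n + 1)) :=
  ⟨Fin.cons (s : ℝ) fun i => (1 - (s : ℝ)) * t i, by
    refine ⟨Fin.cases s.2.1 fun i => mul_nonneg (sub_nonneg.mpr s.2.2) (t.2.1 i), ?_⟩
    · rw [Fin.sum_univ_succ]
      simp only [Fin.cons_zero, Fin.cons_succ]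
      rw [← Finset.mul_sum, stdSimplex.sum_eq_one]
      ring⟩

@[simp]
theorem simplexCone_apply_zero {n : ℕ} (s : I) (t : stdSimplex ℝ (Fin n)) :
    simplexCone s t 0 = s :=
  rfl

@[simp]
theorem simplexCone_apply_succ {n : ℕ} (s : I) (t : stdSimplex ℝ (Fin n)) (i : Fin n) :
    simplexCone s t i.succ = (1 - (s : ℝ)) * t i :=
  rfl

theorem continuous_simplexCone {n : ℕ} :
    Continuous fun p : stdSimplex ℝ (Fin n) × I => simplexCone p.2 p.1 := by
  refine Continuous.subtype_mk (continuous_pi (Fin.cases ?_ fun i => ?_)) _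
  · exact continuous_subtype_val.comp continuous_snd
  · have h : Continuous fun p : stdSimplex ℝ (Fin n) × I => (p.1 : Fin n → ℝ) i :=
      (continuous_apply i).comp (continuous_subtype_val.comp continuous_fst)
    exact (continuous_const.sub (continuous_subtype_val.comp continuous_snd)).mul h

theorem simplexCone_zero {n : ℕ} (t : stdSimplex ℝ (Fin n)) :
    simplexCone 0 t = stdSimplex.map Fin.succ t := by
  ext j
  rw [stdSimplex.map_coe, FunOnFinite.linearMap_apply_apply]
  refine Fin.cases ?_ (fun i => ?_) j
  · simp [Fin.succ_ne_zero]
  · simp [Finset.sum_filter]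

theorem simplexCone_one {n : ℕ} (t : stdSimplex ℝ (Fin n)) :
    simplexCone 1 t = stdSimplex.vertex 0 := by
  ext j
  refine Fin.cases ?_ (fun i => ?_) j
  · simp
  · simp

/-- Coning is functorial in the simplex; this makes the simplexwise paths compatible with faces and
degeneracies. -/
theorem map_simplexCone {m n : ℕ} (f : Fin m → Fin n) (s : I) (t : stdSimplex ℝ (Fin m)) :
    stdSimplex.map (Fin.cons 0 fun i => (f i).succ : Fin (m + 1) → Fin (n + 1)) (simplexCone s t) =
      simplexCone s (stdSimplex.map f t) := by
  ext j
  rw [stdSimplex.map_coe, FunOnFinite.linearMap_apply_apply, Finset.sum_filter,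
    Fin.sum_univ_succ]
  refine Fin.cases ?_ (fun i => ?_) j
  · simp
  · simp [FunOnFinite.linearMap_apply_apply, Finset.sum_filter, Finset.mul_sum,
      (Fin.succ_ne_zero _).symm]

/-- The extension of a monotone map of finite ordinals by a new least element. -/
def simplexCategoryCone {m n : SimplexCategory} (f : m ⟶ n) :
    SimplexCategory.mk (m.len + 1) ⟶ SimplexCategory.mk (n.len + 1) :=
  SimplexCategory.mkHom
    { toFun := Fin.cons 0 fun i => (f i).succ
      monotone' := by
        refine Fin.cases (fun j _ => Fin.zero_le _) (fun i => ?_)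
        refine Fin.cases (fun h => ?_) (fun j h => ?_)
        · exact absurd h (by simp)
        · exact Fin.succ_le_succ_iff.mpr
            (f.toOrderHom.monotone (Fin.succ_le_succ_iff.mp h)) }

variable {C D : Type u₁} [Category.{v₁} C] [Category.{v₁} D]

/-- The simplex of the nerve obtained by applying a functor to a simplex and adding a new initial
vertex. -/
def nerveCone (F : C ⥤ D) (d : D) (h : ∀ c, d ⟶ F.obj c) {n : SimplexCategory}
    (x : (nerve C).obj (op n)) : (nerve D).obj (op (SimplexCategory.mk (n.len + 1))) :=
  ComposableArrows.precomp ((nerveMap F).app _ x) (h (x.obj 0))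

/-- In a thin category a simplex of the nerve is determined by its vertices, so no coherence between
the chosen arrows `h c` has to be assumed. -/
theorem nerve_map_nerveCone [Quiver.IsThin D] (F : C ⥤ D) (d : D) (h : ∀ c, d ⟶ F.obj c)
    {m n : SimplexCategory} (f : m ⟶ n) (x : (nerve C).obj (op n)) :
    (nerve D).map (simplexCategoryCone f).op (nerveCone F d h x) =
      nerveCone F d h ((nerve C).map f.op x) := by
  apply nerve.ext_of_isThin
  funext j
  exact Fin.cases rfl (fun i => rfl) j

theorem nerveMap_nerveCone {C' D' : Type u₁} [Category.{v₁} C'] [Category.{v₁} D']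
    [Quiver.IsThin D'] {F : C ⥤ D} {d : D} (h : ∀ c, d ⟶ F.obj c) {F' : C' ⥤ D'} {d' : D'}
    (h' : ∀ c, d' ⟶ F'.obj c) (G : C ⥤ C') (K : D ⥤ D')
    (hK : ∀ c, K.obj (F.obj c) = F'.obj (G.obj c)) (hd : K.obj d = d')
    {n : SimplexCategory} (x : (nerve C).obj (op n)) :
    (nerveMap K).app _ (nerveCone F d h x) = nerveCone F' d' h' ((nerveMap G).app _ x) := by
  apply nerve.ext_of_isThin
  funext j
  exact Fin.cases hd (fun i => hK _) j

/-- The vertex of a classifying space given by an object. -/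
noncomputable def vertexPoint (c : C) : classifyingSpace C :=
  realizationSimplex (S := nerve C) (n := SimplexCategory.mk 0) (ComposableArrows.mk₀ c)
    (stdSimplex.vertex 0)

theorem classifyingSpaceMap_vertexPoint (F : C ⥤ D) (c : C) :
    classifyingSpaceMap F (vertexPoint c) = vertexPoint (F.obj c) := by
  refine (toTop_map_realizationSimplex _ _ _).trans ?_
  rw [nerveMap_app_mk₀]
  rfl

theorem realizationSimplex_vertex {n : SimplexCategory} (x : (nerve C).obj (op n))
    (i : Fin (n.len + 1)) :
    realizationSimplex x (stdSimplex.vertex i) = vertexPoint (x.obj i) := by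
  have h : (nerve C).map (SimplexCategory.const (SimplexCategory.mk 0) n i).op x =
      ComposableArrows.mk₀ (x.obj i) := ComposableArrows.ext₀ rfl
  have h' := realizationSimplex_map (S := nerve C) (SimplexCategory.const (SimplexCategory.mk 0) n i) x
    (stdSimplex.vertex 0)
  rw [stdSimplex.map_vertex] at h'
  rw [vertexPoint, ← h, h']
  rfl

/-- The family of paths from the points of a simplex to the apex of its cone. -/
noncomputable def nerveConePath (F : C ⥤ D) (d : D) (h : ∀ c, d ⟶ F.obj c) {n : SimplexCategory}
    (x : (nerve C).obj (op n)) :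
    C(stdSimplex ℝ (Fin (n.len + 1)), TopCat.of C(I, classifyingSpace D)) :=
  ContinuousMap.curry
    ⟨fun p => realizationSimplex (nerveCone F d h x) (simplexCone p.2 p.1),
      (realizationSimplex (nerveCone F d h x)).continuous.comp continuous_simplexCone⟩

variable [Quiver.IsThin D]

theorem nerveConePath_map (F : C ⥤ D) (d : D) (h : ∀ c, d ⟶ F.obj c) {m n : SimplexCategory}
    (f : m ⟶ n) (x : (nerve C).obj (op n)) (t : stdSimplex ℝ (Fin (m.len + 1))) :
    nerveConePath F d h ((nerve C).map f.op x) t =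
      nerveConePath F d h x (stdSimplex.map f t) := by
  refine ContinuousMap.ext fun s => ?_
  change realizationSimplex (nerveCone F d h ((nerve C).map f.op x)) (simplexCone s t) =
    realizationSimplex (nerveCone F d h x) (simplexCone s (stdSimplex.map f t))
  rw [← nerve_map_nerveCone]
  refine (realizationSimplex_map (S := nerve D) _ _ _).trans ?_
  exact congrArg _ (map_simplexCone _ s t)

/-- For a functor `F : C ⥤ D` into a thin category and an object `d` mapping to every `F c`, the
homotopy from the map induced by `F` to the constant map at `d`. -/
noncomputable def coneHomotopy (F : C ⥤ D) (d : D) (h : ∀ c, d ⟶ F.obj c) :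
    classifyingSpace C ⟶ TopCat.of C(I, classifyingSpace D) :=
  realizationDesc (fun x => nerveConePath F d h x) (nerveConePath_map F d h)

theorem coneHomotopy_simplex (F : C ⥤ D) (d : D) (h : ∀ c, d ⟶ F.obj c) {n : SimplexCategory}
    (x : (nerve C).obj (op n)) (t : stdSimplex ℝ (Fin (n.len + 1))) (s : I) :
    (coneHomotopy F d h (realizationSimplex x t) : C(I, classifyingSpace D)) s =
      realizationSimplex (nerveCone F d h x) (simplexCone s t) :=
  congrArg (fun γ : C(I, classifyingSpace D) => γ s)
    (realizationDesc_simplex (fun x => nerveConePath F d h x) (nerveConePath_map F d h) x t)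

/-- Evaluation of paths at a parameter. -/
noncomputable def evalPath (X : TopCat.{u}) (s : I) : TopCat.of C(I, X) ⟶ X :=
  TopCat.ofHom ⟨fun γ => γ s, continuous_eval_const s⟩

theorem coneHomotopy_zero (F : C ⥤ D) (d : D) (h : ∀ c, d ⟶ F.obj c) (b : classifyingSpace C) :
    (coneHomotopy F d h b : C(I, classifyingSpace D)) 0 = classifyingSpaceMap F b := by
  suffices H : coneHomotopy F d h ≫ evalPath _ 0 = classifyingSpaceMap F from
    ConcreteCategory.congr_hom H b
  refine realization_hom_ext (fun n x t => ?_)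
  refine (coneHomotopy_simplex F d h x t 0).trans ?_
  refine Eq.trans ?_ (toTop_map_realizationSimplex _ x t).symm
  rw [simplexCone_zero]
  -- The base of the cone is the face opposite the new vertex 0, hence the coface `δ 0`.
  exact (realizationSimplex_map (S := nerve D) (SimplexCategory.δ 0) (nerveCone F d h x) t).symm

theorem coneHomotopy_one (F : C ⥤ D) (d : D) (h : ∀ c, d ⟶ F.obj c) (b : classifyingSpace C) :
    (coneHomotopy F d h b : C(I, classifyingSpace D)) 1 = vertexPoint d := by
  suffices H : coneHomotopy F d h ≫ evalPath _ 1 =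
      TopCat.ofHom (ContinuousMap.const _ (vertexPoint d)) from
    ConcreteCategory.congr_hom H b
  refine realization_hom_ext (fun n x t => ?_)
  refine (coneHomotopy_simplex F d h x t 1).trans ?_
  rw [simplexCone_one]
  exact realizationSimplex_vertex (nerveCone F d h x) 0

/-- Needed for the homotopies over different undercategories to respect the gluing relation of a
homotopy colimit. -/
theorem coneHomotopy_naturality {C' D' : Type u₁} [Category.{v₁} C'] [Category.{v₁} D']
    [Quiver.IsThin D'] {F : C ⥤ D} {d : D} (h : ∀ c, d ⟶ F.obj c) {F' : C' ⥤ D'} {d' : D'}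
    (h' : ∀ c, d' ⟶ F'.obj c) (G : C ⥤ C') (K : D ⥤ D')
    (hK : ∀ c, K.obj (F.obj c) = F'.obj (G.obj c)) (hd : K.obj d = d')
    (b : classifyingSpace C) (s : I) :
    classifyingSpaceMap K ((coneHomotopy F d h b : C(I, classifyingSpace D)) s) =
      (coneHomotopy F' d' h' (classifyingSpaceMap G b) : C(I, classifyingSpace D')) s := by
  suffices H : coneHomotopy F d h ≫ evalPath _ s ≫ classifyingSpaceMap K =
      classifyingSpaceMap G ≫ coneHomotopy F' d' h' ≫ evalPath _ s from
    ConcreteCategory.congr_hom H b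
  refine realization_hom_ext (fun n x t => ?_)
  have e₁ := coneHomotopy_simplex F d h x t s
  have e₂ := coneHomotopy_simplex F' d' h' ((nerveMap G).app _ x) t s
  have e₃ : classifyingSpaceMap G (realizationSimplex x t) = _ :=
    toTop_map_realizationSimplex (nerveMap G) x t
  have e₄ : classifyingSpaceMap K (realizationSimplex (nerveCone F d h x) (simplexCone s t)) = _ :=
    toTop_map_realizationSimplex (nerveMap K) (nerveCone F d h x) (simplexCone s t)
  rw [nerveMap_nerveCone h h' G K hK hd x] at e₄
  refine (congrArg (classifyingSpaceMap K) e₁).trans (e₄.trans ?_)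
  refine e₂.symm.trans ?_
  exact congrArg (fun y => (coneHomotopy F' d' h' y : C(I, classifyingSpace D')) s) e₃.symm

end Cone

/-! ### Maps into and out of homotopy colimits -/

section HocolimMaps

open Opposite

variable {I J : Type} [SmallCategory I] [SmallCategory J]

/-- The inclusion of `D(i)` into the homotopy colimit, at the vertex `𝟙 i` of `ℬ (i ↓ I)ᵒᵖ`. -/
noncomputable def hocolimInclusion (D : I ⥤ TopCat.{w}) (i : I) : D.obj i ⟶ hocolim D :=
  TopCat.ofHom
    { toFun := fun x => Quot.mk _ ⟨i, (x, vertexPoint (op (Under.mk (𝟙 i))))⟩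
      continuous_toFun := continuous_quot_mk.comp
        ((continuous_sigmaMk (σ := fun i : I => D.obj i × underSpace i)).comp
          (continuous_id.prodMk continuous_const)) }

theorem hocolimInclusion_reindex (F : I ⥤ J) (D : J ⥤ TopCat.{w}) (i : I) :
    hocolimInclusion (F ⋙ D) i ≫ hocolimReindex F D = hocolimInclusion D (F.obj i) := by
  ext x
  have h : underSpacePost F i (vertexPoint (op (Under.mk (𝟙 i)))) =
      vertexPoint (op (Under.mk (𝟙 (F.obj i)))) := by
    refine (classifyingSpaceMap_vertexPoint _ _).trans ?_
    exact congrArg (fun f => vertexPoint (op (Under.mk f))) (F.map_id i)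
  exact congrArg (fun b => Quot.mk (HocolimRel D) ⟨F.obj i, (x, b)⟩) h

/-- The gluing relation trades moving x along f for moving the vertex `𝟙 j` back along
precomposition by f. This identifies the end of each contraction with a point of D at the target. -/
theorem hocolimInclusion_map (D : I ⥤ TopCat.{w}) {i j : I} (f : i ⟶ j) (x : D.obj i) :
    hocolimInclusion D j (D.map f x) =
      (Quot.mk (HocolimRel D) ⟨i, (x, vertexPoint (op (Under.mk f)))⟩ : hocolim D) := by
  have h : underSpaceMap f (vertexPoint (op (Under.mk (𝟙 j)))) = vertexPoint (op (Under.mk f)) := by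
    refine (classifyingSpaceMap_vertexPoint _ _).trans ?_
    exact congrArg (fun f => vertexPoint (op (Under.mk f))) (Category.comp_id f)
  rw [← h]
  exact Quot.sound (HocolimRel.glue f x _)

/-- The map out of the homotopy colimit induced by a cocone, collapsing the classifying spaces. -/
noncomputable def hocolimDesc (D : I ⥤ TopCat.{w}) {Z : TopCat.{w}} (a : ∀ i, D.obj i ⟶ Z)
    (ha : ∀ {i j : I} (f : i ⟶ j), D.map f ≫ a j = a i) : hocolim D ⟶ Z :=
  TopCat.ofHom
    { toFun := Quot.lift (fun p => a p.1 p.2.1) (by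
        rintro _ _ ⟨f, x, b⟩
        exact ConcreteCategory.congr_hom (ha f) x)
      continuous_toFun := continuous_quot_lift _ (continuous_sigma fun i =>
        (a i).hom.continuous.comp continuous_fst) }

instance under_op_isThin [Quiver.IsThin J] (j : J) : Quiver.IsThin (Under j)ᵒᵖ := fun _ _ =>
  ⟨fun _ _ => Quiver.Hom.unop_inj (Under.UnderMorphism.ext (Subsingleton.elim _ _))⟩

variable [Quiver.IsThin J]

/-- The homotopy `ℬ (i ↓ I)ᵒᵖ → ℬ (F i ↓ J)ᵒᵖ` from the map induced by `F` to the constant map at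
an object to which every `F k` maps. -/
noncomputable def underConeHomotopy (F : I ⥤ J) {m : J} (α : ∀ i, F.obj i ⟶ m) (i : I) :
    underSpace i ⟶ TopCat.of C(unitInterval, underSpace (F.obj i)) :=
  -- The object `α i` receives an arrow from every F c, so in the opposite category it maps to all
  -- of them and can serve as the new initial vertex.
  coneHomotopy (Under.post F).op (op (Under.mk (α i))) fun c =>
    (Under.homMk (α c.unop.right) (Subsingleton.elim _ _) :
      (Under.post F).obj c.unop ⟶ Under.mk (α i)).op

theorem underConeHomotopy_zero (F : I ⥤ J) {m : J} (α : ∀ i, F.obj i ⟶ m) (i : I)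
    (b : underSpace i) :
    (underConeHomotopy F α i b : C(unitInterval, underSpace (F.obj i))) 0 =
      underSpacePost F i b :=
  coneHomotopy_zero _ _ _ b

theorem underConeHomotopy_one (F : I ⥤ J) {m : J} (α : ∀ i, F.obj i ⟶ m) (i : I)
    (b : underSpace i) :
    (underConeHomotopy F α i b : C(unitInterval, underSpace (F.obj i))) 1 =
      vertexPoint (op (Under.mk (α i))) :=
  coneHomotopy_one _ _ _ b

theorem underConeHomotopy_naturality (F : I ⥤ J) {m : J} (α : ∀ i, F.obj i ⟶ m) {i j : I}
    (f : i ⟶ j) (b : underSpace j) (s : unitInterval) :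
    underSpaceMap (F.map f)
        ((underConeHomotopy F α j b : C(unitInterval, underSpace (F.obj j))) s) =
      (underConeHomotopy F α i (underSpaceMap f b) : C(unitInterval, underSpace (F.obj i))) s :=
  coneHomotopy_naturality _ _ (Under.map f).op (Under.map (F.map f)).op
    (fun _ => congrArg (fun g => op (Under.mk g)) (Subsingleton.elim _ _))
    (congrArg (fun g => op (Under.mk g)) (Subsingleton.elim _ _)) b s

/-- The paths in a homotopy colimit that contract the classifying spaces of the undercategories to
an object `m` to which every `F i` maps. -/
noncomputable def hocolimConePath (F : I ⥤ J) {m : J} (α : ∀ i, F.obj i ⟶ m)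
    (D : J ⥤ TopCat.{w}) : C(hocolim (F ⋙ D), C(unitInterval, hocolim D)) where
  toFun := Quot.lift
    (fun p : HocolimTotal (F ⋙ D) =>
      (⟨fun s => Quot.mk (HocolimRel D) ⟨F.obj p.1, (p.2.1,
          (underConeHomotopy F α p.1 p.2.2 : C(unitInterval, underSpace (F.obj p.1))) s)⟩,
        continuous_quot_mk.comp
          ((continuous_sigmaMk (σ := fun j : J => D.obj j × underSpace j)).comp
            (continuous_const.prodMk (ContinuousMap.continuous _)))⟩ :
        C(unitInterval, hocolim D))) (by
      rintro _ _ ⟨f, x, b⟩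
      refine ContinuousMap.ext fun s => ?_
      refine (Quot.sound (HocolimRel.glue (F.map f) x _)).trans ?_
      exact congrArg (fun c => Quot.mk (HocolimRel D) ⟨_, (x, c)⟩)
        (underConeHomotopy_naturality F α f b s))
  -- Joint continuity is checked on each summand before passing to the quotient, so it is not needed
  -- that the quotient map times the interval is a quotient map.
  continuous_toFun := continuous_quot_lift _ (continuous_sigma fun i =>
    ContinuousMap.continuous_of_continuous_uncurry _ (continuous_quot_mk.comp
      ((continuous_sigmaMk (σ := fun j : J => D.obj j × underSpace j)).comp
        ((continuous_fst.comp continuous_fst).prodMk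
          (Continuous.eval ((underConeHomotopy F α i).hom.continuous.comp
            (continuous_snd.comp continuous_fst)) continuous_snd)))))

/-- If every `F i` maps to `m`, then the change of indexing category along `F` is homotopic to the
map that factors through the inclusion of `D(m)`. -/
noncomputable def hocolimReindexHomotopy (F : I ⥤ J) {m : J} (α : ∀ i, F.obj i ⟶ m)
    (D : J ⥤ TopCat.{w})
    (hα : ∀ {i j : I} (f : i ⟶ j), (F ⋙ D).map f ≫ D.map (α j) = D.map (α i)) :
    TopCat.Homotopy (hocolimReindex F D)
      (hocolimDesc (F ⋙ D) (fun i => D.map (α i)) hα ≫ hocolimInclusion D m) where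
  toFun p := hocolimConePath F α D p.2 p.1
  continuous_toFun :=
    Continuous.eval ((hocolimConePath F α D).continuous.comp continuous_snd) continuous_fst
  map_zero_left := by
    rintro ⟨i, x, b⟩
    exact congrArg (fun c => Quot.mk (HocolimRel D) ⟨F.obj i, (x, c)⟩)
      (underConeHomotopy_zero F α i b)
  map_one_left := by
    rintro ⟨i, x, b⟩
    refine (congrArg (fun c => Quot.mk (HocolimRel D) ⟨F.obj i, (x, c)⟩)
      (underConeHomotopy_one F α i b)).trans ?_
    exact (hocolimInclusion_map D (α i) x).symm

/-- A path in `ℬ (j ↓ J)ᵒᵖ` from the vertex `𝟙 j` to the vertex given by a morphism `f : j ⟶ k`. -/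
noncomputable def underPath {j k : J} (f : j ⟶ k) : C(unitInterval, underSpace j) :=
  coneHomotopy ((Functor.const (Under j)ᵒᵖ).obj (op (Under.mk (𝟙 j)))) (op (Under.mk f))
    (fun _ => (Under.homMk f (Subsingleton.elim _ _) : Under.mk (𝟙 j) ⟶ Under.mk f).op)
    -- Any base point would do: the constant functor sends all of them to the vertex `𝟙 j`.
    (vertexPoint (op (Under.mk f)))

/-- The inclusions of the spaces of a diagram into its homotopy colimit are compatible with the
maps of the diagram up to homotopy. -/
noncomputable def hocolimInclusionHomotopy (D : J ⥤ TopCat.{w}) {j k : J} (f : j ⟶ k) :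
    TopCat.Homotopy (hocolimInclusion D j) (D.map f ≫ hocolimInclusion D k) where
  toFun p := Quot.mk (HocolimRel D) ⟨j, (p.2, underPath f p.1)⟩
  continuous_toFun := continuous_quot_mk.comp
    ((continuous_sigmaMk (σ := fun j : J => D.obj j × underSpace j)).comp
      (continuous_snd.prodMk ((underPath f).continuous.comp continuous_fst)))
  map_zero_left x := congrArg (fun c => Quot.mk (HocolimRel D) ⟨j, (x, c)⟩)
    ((coneHomotopy_zero _ _ _ _).trans (classifyingSpaceMap_vertexPoint _ _))
  map_one_left x := (congrArg (fun c => Quot.mk (HocolimRel D) ⟨j, (x, c)⟩)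
    (coneHomotopy_one _ _ _ _)).trans (hocolimInclusion_map D f x).symm

end HocolimMaps

/-! ### The interleaving -/

section TensorInterleaving

variable (X Y : PosReal ⥤ TopCat.{w})

theorem exp_add_log_two (r : ℝ) : Real.exp (r + Real.log 2) = Real.exp r + Real.exp r := by
  rw [Real.exp_add, Real.exp_log two_pos, mul_two]

/-- The point `(e^r, e^r)` of `△_t` for `2 e^r ≤ t`. -/
noncomputable def triangleDiag (r : ℝ) {t : ℝ} (h : r + Real.log 2 ≤ t) :
    Triangle (expFunctor.obj t) :=
  ⟨(expFunctor.obj r, expFunctor.obj r),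
    (exp_add_log_two r).symm.le.trans (Real.exp_le_exp.mpr h)⟩

/-- Each coordinate is at most the sum because the other one is positive. -/
theorem le_diag_of_triangle {r : ℝ} (p : Triangle (expFunctor.obj r)) {s : ℝ} (h : r ≤ s) :
    p.1 ≤ (expFunctor.obj s, expFunctor.obj s) := by
  have hp : (p.1.1 : ℝ) + (p.1.2 : ℝ) ≤ Real.exp s := p.2.trans (Real.exp_le_exp.mpr h)
  have h₁ := p.1.1.2
  have h₂ := p.1.2.2
  refine ⟨Subtype.coe_le_coe.mp ?_, Subtype.coe_le_coe.mp ?_⟩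
  · change (p.1.1 : ℝ) ≤ Real.exp s
    linarith
  · change (p.1.2 : ℝ) ≤ Real.exp s
    linarith

/-- The map `X_{e^r} × Y_{e^r} → (𝒳 ⊗ 𝒴)_{2 e^r}`. -/
noncomputable def productToTensor (r : ℝ) :
    (lnDiagram (catProduct X Y)).obj r ⟶ (lnDiagram (genTensor X Y)).obj (r + Real.log 2) :=
  hocolimInclusion (triangleIncl (expFunctor.obj (r + Real.log 2)) ⋙ boxProduct X Y)
    (triangleDiag r le_rfl)

/-- The map `(𝒳 ⊗ 𝒴)_{e^r} → X_{e^s} × Y_{e^s}` for `r ≤ s`. -/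
noncomputable def tensorToProduct {r s : ℝ} (h : r ≤ s) :
    (lnDiagram (genTensor X Y)).obj r ⟶ (lnDiagram (catProduct X Y)).obj s :=
  hocolimDesc (triangleIncl (expFunctor.obj r) ⋙ boxProduct X Y)
    (Z := (lnDiagram (catProduct X Y)).obj s)
    (fun p => (boxProduct X Y).map (homOfLE (le_diag_of_triangle p h).1,
      homOfLE (le_diag_of_triangle p h).2))
    (fun _ => ((boxProduct X Y).map_comp _ _).symm)

theorem tensorToProduct_map {r s t : ℝ} (h : r ≤ s) (f : s ⟶ t) :
    tensorToProduct X Y h ≫ (lnDiagram (catProduct X Y)).map f =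
      tensorToProduct X Y (h.trans (leOfHom f)) := by
  ext p
  obtain ⟨i, x, b⟩ := p
  exact (ConcreteCategory.congr_hom ((boxProduct X Y).map_comp _ _) x).symm

theorem map_tensorToProduct {r s t : ℝ} (f : r ⟶ s) (h : s ≤ t) :
    (lnDiagram (genTensor X Y)).map f ≫ tensorToProduct X Y h =
      tensorToProduct X Y ((leOfHom f).trans h) := by
  ext p
  obtain ⟨i, x, b⟩ := p
  rfl

/-- Collapsing forgets the classifying space coordinate, and what remains is the structure map out
of (e^r, e^r); no homotopy is needed. -/
theorem productToTensor_tensorToProduct (r : ℝ) {t : ℝ} (h : r + Real.log 2 ≤ t) (f : r ⟶ t) :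
    productToTensor X Y r ≫ tensorToProduct X Y h = (lnDiagram (catProduct X Y)).map f :=
  rfl

/-- The maps into the tensor product are natural up to homotopy. -/
noncomputable def productToTensorHomotopy {r s : ℝ} (f : r ⟶ s) :
    TopCat.Homotopy
      (productToTensor X Y r ≫
        (lnDiagram (genTensor X Y)).map ((translation (Real.log 2)).map f))
      ((lnDiagram (catProduct X Y)).map f ≫ productToTensor X Y s) :=
  hocolimInclusionHomotopy (triangleIncl (expFunctor.obj (s + Real.log 2)) ⋙ boxProduct X Y)
    (j := triangleDiag r (add_le_add_left (leOfHom f) _)) (k := triangleDiag s le_rfl)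
    -- The homotopy takes place inside △ at 2e^s, which contains both (e^r, e^r) and (e^s, e^s); the
    -- cast identifies its start with the inclusion at (e^r, e^r) followed by reindexing.
    (homOfLE ⟨leOfHom (expFunctor.map f), leOfHom (expFunctor.map f)⟩) |>.cast (by
      exact congrArg TopCat.Hom.hom (Eq.symm <| hocolimInclusion_reindex
        (triangleMap (leOfHom (expFunctor.map ((translation (Real.log 2)).map f))))
        (triangleIncl (expFunctor.obj (s + Real.log 2)) ⋙ boxProduct X Y)
        (triangleDiag r le_rfl))) rfl

/-- Passing to the product and back is homotopic to the transition map of the tensor product. -/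
noncomputable def tensorToProductToTensorHomotopy {r s : ℝ} (h : r ≤ s)
    (f : r ⟶ s + Real.log 2) :
    TopCat.Homotopy ((lnDiagram (genTensor X Y)).map f)
      (tensorToProduct X Y h ≫ productToTensor X Y s) :=
  hocolimReindexHomotopy (triangleMap (leOfHom (expFunctor.map f)))
    (m := triangleDiag s le_rfl) (fun p => homOfLE (le_diag_of_triangle p h))
    (triangleIncl (expFunctor.obj (s + Real.log 2)) ⋙ boxProduct X Y)
    (fun _ => ((boxProduct X Y).map_comp _ _).symm)

theorem diagramHomology_areInterleaved (F : Type u) [Field F] (n : ℕ) :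
    AreInterleaved (Real.log 2)
      (diagramHomology F n (lnDiagram (catProduct X Y)))
      (diagramHomology F n (lnDiagram (genTensor X Y))) := by
  have h2 : 0 ≤ Real.log 2 := Real.log_nonneg one_le_two
  let H : TopCat.{w} ⥤ ModuleCat.{max u w} F :=
    (AlgebraicTopology.singularHomologyFunctor (ModuleCat.{max u w} F) n).obj
      (ModuleCat.of F (ULift.{w} F))
  have H_congr {A B : TopCat.{w}} {f g : A ⟶ B} (h : TopCat.Homotopy f g) : H.map f = H.map g :=
    h.congr_homologyMap_singularChainComplexFunctor _ n
  refine ⟨h2,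
    { app := fun r => H.map (productToTensor X Y r)
      naturality := fun r s f => ?_ },
    { app := fun r => H.map (tensorToProduct X Y (le_add_of_nonneg_right h2))
      naturality := fun r s f => ?_ }, fun r => ?_, fun r => ?_⟩
  -- Only this naturality square and the last composite use homotopy invariance; the other two
  -- conditions hold already for spaces.
  · exact ((H.map_comp _ _).symm.trans (H_congr (productToTensorHomotopy X Y f)).symm).trans
      (H.map_comp _ _)
  · refine ((H.map_comp _ _).symm.trans (congrArg H.map ?_)).trans (H.map_comp _ _)
    exact (map_tensorToProduct X Y f _).trans (tensorToProduct_map X Y _ _).symm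
  · exact (H.map_comp _ _).symm.trans
      (congrArg H.map (productToTensor_tensorToProduct X Y r _ _))
  · exact (H.map_comp _ _).symm.trans
      (H_congr (tensorToProductToTensorHomotopy X Y (le_add_of_nonneg_right h2) _)).symm

end TensorInterleaving

theorem mainTheorem7 (F : Type u) [Field F] (n : ℕ) (X Y : PosReal ⥤ TopCat.{w}) :
    AreInterleaved (Real.log 2)
        (diagramHomology F n (lnDiagram (catProduct X Y)))
        (diagramHomology F n (lnDiagram (genTensor X Y))) ∧
      interleavingDistance
          (diagramHomology F n (lnDiagram (catProduct X Y)))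
          (diagramHomology F n (lnDiagram (genTensor X Y))) ≤
        ENNReal.ofReal (Real.log 2) :=
  ⟨diagramHomology_areInterleaved X Y F n,
    iInf₂_le (Real.log 2) (diagramHomology_areInterleaved X Y F n)⟩
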